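/- Let $T$ be a finite (nonempty) tree with adjacency matrix $A(T)$. An arithmetical structure on $T$ is a pair $(\mathbf d,\mathbf r)$ of vectors in $\mathbb{Z}^{V(T)}$ such that $\mathbf d$ has nonnegative entries, $\mathbf r$ has positive entries with no nontrivial common factor, and $(\operatorname{diag}(\mathbf d)-A(T))\,\mathbf r=\mathbf 0$. Its critical group is the torsion subgroup of the cokernel $\mathbb{Z}^{V(T)}/\operatorname{im}(\operatorname{diag}(\mathbf d)-A(T))$. The critical group of every arithmetical structure on $T$ is cyclic if and only if (a) $T$ does not have two distinct non-adjacent vertices of degree at least $3$, and (b) $T$ has no vertex of degree at least $4$. Furthermore, the critical group of every arithmetical structure on $T$ is trivial if and only if $T$ is a path graph (a single vertex counting as a path graph). -/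

import Mathlib

/-- An arithmetical structure on a (simple) graph `G` with finite vertex set: a pair `(d, r)` of
integer vectors indexed by the vertices, where `d` has nonnegative entries, `r` has positive
entries with no nontrivial common factor, and `(diag d - A(G)) r = 0`. -/
structure ArithmeticalStructure {V : Type*} [Fintype V] [DecidableEq V]
    (G : SimpleGraph V) [DecidableRel G.Adj] where
  d : V → ℤ
  r : V → ℤ
  d_nonneg : ∀ v, 0 ≤ d v
  r_pos : ∀ v, 0 < r v
  gcd_r : Finset.univ.gcd r = 1
  mulVec_eq_zero : Matrix.mulVec (Matrix.diagonal d - G.adjMatrix ℤ) r = 0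

namespace ArithmeticalStructure

variable {V : Type*} [Fintype V] [DecidableEq V] {G : SimpleGraph V} [DecidableRel G.Adj]

/-- The generalized Laplacian matrix `diag d - A(G)`. -/
def laplacian (S : ArithmeticalStructure G) : Matrix V V ℤ :=
  Matrix.diagonal S.d - G.adjMatrix ℤ

/-- The cokernel `ℤ^V / im (diag d - A(G))` of the generalized Laplacian matrix. -/
abbrev Cokernel (S : ArithmeticalStructure G) : Type _ :=
  (V → ℤ) ⧸ LinearMap.range S.laplacian.mulVecLin

/-- The critical group: the torsion subgroup of the cokernel of the generalized Laplacian. -/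
abbrev CriticalGroup (S : ArithmeticalStructure G) : Type _ :=
  AddCommGroup.torsion S.Cokernel

end ArithmeticalStructure

/-! Pairing with `r` maps the cokernel onto `ℤ` and kills torsion, so a cokernel generated by one
element has trivial torsion and one generated by two has cyclic torsion. Generators are counted by
forcing (`gen_mem_of_forall_ne`): once `v` and all but one of its neighbours lie in a submodule, the
relation at `v` puts the last neighbour there too. An end of a path forces the whole path; when (a)
and (b) hold, two well-chosen vertices force the tree.

For the converses, let `r` be the degree on an independent set `W` and 1 elsewhere. If `a`, `b` are
neighbours of `v ∈ W` whose branches avoid `W`, the Laplacian sends the difference of the two branch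
indicators to `deg v • (e_a - e_b)`. So `e_a - e_b` is torsion, and modulo `deg v` the same
difference of indicators is a functional on the cokernel. Such functionals detect nonzero torsion at
a vertex of degree at least 3. A nonzero 2×2 determinant of their values excludes cyclicity, with `W
= {v}` for degree at least 4 and `W = {u, v}` for two non-adjacent vertices of degree 3. -/

namespace ArithmeticalStructure

/-! ### Generators, relations and functionals of the cokernel. -/

section Generators

variable {V : Type*} [Fintype V] [DecidableEq V] {G : SimpleGraph V} [DecidableRel G.Adj]

/-- The class of the basis vector at `v` in the cokernel. -/
def gen (S : ArithmeticalStructure G) (v : V) : S.Cokernel :=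
  Submodule.Quotient.mk (Pi.single v 1)

theorem laplacian_mulVec_apply (S : ArithmeticalStructure G) (x : V → ℤ) (v : V) :
    (S.laplacian.mulVec x) v = S.d v * x v - ∑ u ∈ G.neighborFinset v, x u := by
  simp [laplacian, Matrix.sub_mulVec, Matrix.mulVec_diagonal]

theorem d_mul_r (S : ArithmeticalStructure G) (v : V) :
    S.d v * S.r v = ∑ u ∈ G.neighborFinset v, S.r u := by
  have h := congrFun S.mulVec_eq_zero v
  have h' := S.laplacian_mulVec_apply S.r v
  rw [laplacian, h] at h'
  exact (sub_eq_zero.mp h'.symm)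

theorem mk_eq_sum (S : ArithmeticalStructure G) (x : V → ℤ) :
    (Submodule.Quotient.mk x : S.Cokernel) = ∑ v, x v • S.gen v := by
  conv_lhs => rw [pi_eq_sum_univ' x]
  simp only [gen, ← Submodule.mkQ_apply, map_sum, ← map_smul]

theorem d_smul_gen (S : ArithmeticalStructure G) (v : V) :
    S.d v • S.gen v = ∑ u ∈ G.neighborFinset v, S.gen u := by
  have h : (Submodule.Quotient.mk (S.laplacian.mulVec (Pi.single v 1)) : S.Cokernel) = 0 :=
    (Submodule.Quotient.mk_eq_zero _).mpr ⟨Pi.single v 1, rfl⟩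
  rw [mk_eq_sum] at h
  simp only [laplacian_mulVec_apply, sub_smul, Finset.sum_sub_distrib, sub_eq_zero] at h
  have h1 : ∑ u, (S.d u * (Pi.single v 1 : V → ℤ) u) • S.gen u = S.d v • S.gen v := by
    rw [Finset.sum_eq_single v]
    · simp
    · intro b _ hb
      simp [hb]
    · simp
  have h2 : ∑ u, (∑ w ∈ G.neighborFinset u, (Pi.single v 1 : V → ℤ) w) • S.gen u =
      ∑ u ∈ G.neighborFinset v, S.gen u := by
    rw [← Finset.sum_filter_add_sum_filter_not Finset.univ (fun u => G.Adj v u)]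
    rw [Finset.sum_eq_zero (s := Finset.univ.filter fun u => ¬ G.Adj v u), add_zero]
    · refine Finset.sum_congr (by ext; simp) fun u hu => ?_
      have hu' : G.Adj u v := (by simpa using hu : G.Adj v u).symm
      simp [hu']
    · intro u hu
      have hu' : ¬ G.Adj u v := fun h => (by simpa using hu : ¬ G.Adj v u) h.symm
      simp [hu']
  rw [← h1, h, h2]

theorem gen_mem_of_forall_ne {S : ArithmeticalStructure G} {N : Submodule ℤ S.Cokernel} {v w : V}
    (hvw : G.Adj v w) (hv : S.gen v ∈ N) (h : ∀ u, G.Adj v u → u ≠ w → S.gen u ∈ N) :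
    S.gen w ∈ N := by
  have key := S.d_smul_gen v
  rw [← Finset.add_sum_erase _ _ ((G.mem_neighborFinset v w).mpr hvw)] at key
  have hw : S.gen w = S.d v • S.gen v - ∑ u ∈ (G.neighborFinset v).erase w, S.gen u := by
    rw [key]; abel
  rw [hw]
  refine N.sub_mem (N.smul_mem _ hv) (N.sum_mem fun u hu => ?_)
  rw [Finset.mem_erase, SimpleGraph.mem_neighborFinset] at hu
  exact h u hu.2 hu.1

theorem eq_top_of_forall_gen_mem {S : ArithmeticalStructure G} {N : Submodule ℤ S.Cokernel}
    (h : ∀ v, S.gen v ∈ N) : N = ⊤ := by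
  refine eq_top_iff.mpr fun c _ => ?_
  obtain ⟨x, rfl⟩ := Submodule.Quotient.mk_surjective _ c
  rw [mk_eq_sum]
  exact N.sum_mem fun v _ => N.smul_mem _ (h v)

/-- A vector in the left kernel of the Laplacian, over any commutative ring, gives a homomorphism
out of the cokernel. -/
def pairing {R : Type*} [CommRing R] (S : ArithmeticalStructure G) (c : V → R)
    (hc : ∀ v, (S.d v : R) * c v = ∑ u ∈ G.neighborFinset v, c u) : S.Cokernel →ₗ[ℤ] R :=
  Submodule.liftQ _ (∑ v, ((LinearMap.toSpanSingleton ℤ R (c v)).comp (LinearMap.proj v))) <| by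
    rintro _ ⟨x, rfl⟩
    have h1 : ∀ v : V, ∑ u ∈ G.neighborFinset v, (x u : R) * c v =
        ∑ u, if G.Adj v u then (x u : R) * c v else 0 := fun v => by
      rw [← Finset.sum_filter]
      exact Finset.sum_congr (by ext; simp) fun _ _ => rfl
    have h2 : ∀ v : V, ∑ u ∈ G.neighborFinset v, (x v : R) * c u =
        ∑ u, if G.Adj v u then (x v : R) * c u else 0 := fun v => by
      rw [← Finset.sum_filter]
      exact Finset.sum_congr (by ext; simp) fun _ _ => rfl
    rw [LinearMap.mem_ker]
    simp only [LinearMap.sum_apply, LinearMap.comp_apply, LinearMap.proj_apply,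
      LinearMap.toSpanSingleton_apply, Matrix.mulVecLin_apply, laplacian_mulVec_apply,
      zsmul_eq_mul, Int.cast_sub, Int.cast_mul, Int.cast_sum, sub_mul, Finset.sum_sub_distrib,
      Finset.sum_mul]
    rw [sub_eq_zero]
    have h3 : ∀ v : V, (S.d v : R) * x v * c v =
        ∑ u ∈ G.neighborFinset v, (x v : R) * c u := fun v => by
      rw [← Finset.mul_sum, ← hc]; ring
    simp only [h1, h2, h3]
    -- Symmetry of adjacency turns the right-kernel equation `hc` into a left-kernel one.
    rw [Finset.sum_comm]
    simp only [G.adj_comm]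

@[simp]
theorem pairing_gen {R : Type*} [CommRing R] (S : ArithmeticalStructure G) (c : V → R)
    (hc : ∀ v, (S.d v : R) * c v = ∑ u ∈ G.neighborFinset v, c u) (v : V) :
    S.pairing c hc (S.gen v) = c v := by
  simp only [pairing, gen]
  rw [Submodule.liftQ_apply]
  simp only [LinearMap.sum_apply, LinearMap.comp_apply, LinearMap.proj_apply,
      LinearMap.toSpanSingleton_apply]
  rw [Finset.sum_eq_single v] <;> simp +contextual

/-- Pairing with `r`, a surjection from the cokernel onto `ℤ`. -/
def rank (S : ArithmeticalStructure G) : S.Cokernel →ₗ[ℤ] ℤ :=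
  S.pairing S.r fun v => S.d_mul_r v

theorem exists_rank_eq_one (S : ArithmeticalStructure G) : ∃ c, S.rank c = 1 := by
  obtain ⟨g, hg⟩ := Finset.gcd_eq_sum_mul Finset.univ S.r
  refine ⟨∑ v, g v • S.gen v, ?_⟩
  rw [S.gcd_r] at hg
  simp [rank, hg, mul_comm]

theorem rank_eq_zero_of_mem_torsion {S : ArithmeticalStructure G} {c : S.Cokernel}
    (hc : c ∈ AddCommGroup.torsion S.Cokernel) : S.rank c = 0 := by
  obtain ⟨n, hn, h⟩ := isOfFinAddOrder_iff_nsmul_eq_zero.mp (show IsOfFinAddOrder c from hc)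
  have h' := congrArg S.rank h
  rw [map_nsmul, map_zero] at h'
  exact (smul_eq_zero.mp h').resolve_left hn.ne'

/-- Since `rank x` and `rank y` are coprime, the integer relations `i * rank x + j * rank y = 0` are
the multiples of `(rank y, -rank x)`; the coefficient comes from a Bézout identity. -/
theorem isAddCyclic_of_span_pair {S : ArithmeticalStructure G} {x y : S.Cokernel}
    (h : Submodule.span ℤ {x, y} = ⊤) : IsAddCyclic S.CriticalGroup := by
  obtain ⟨c, hc⟩ := S.exists_rank_eq_one
  obtain ⟨a, b, rfl⟩ := Submodule.mem_span_pair.mp (h ▸ Submodule.mem_top : c ∈ _)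
  have hle : AddCommGroup.torsion S.Cokernel ≤
      AddSubgroup.zmultiples (S.rank y • x - S.rank x • y) := by
    intro t ht
    have ht0 := rank_eq_zero_of_mem_torsion ht
    obtain ⟨i, j, rfl⟩ := Submodule.mem_span_pair.mp (h ▸ Submodule.mem_top : t ∈ _)
    simp only [map_add, map_smul, smul_eq_mul] at hc ht0
    refine AddSubgroup.mem_zmultiples_iff.mpr ⟨i * b - a * j, ?_⟩
    rw [smul_sub, smul_smul, smul_smul]
    have h1 : (i * b - a * j) * S.rank y = i := by linear_combination i * hc - a * ht0
    have h2 : (i * b - a * j) * S.rank x = -j := by linear_combination b * ht0 - j * hc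
    rw [h1, h2, neg_smul, sub_neg_eq_add]
  exact isAddCyclic_of_injective (AddSubgroup.inclusion hle) (AddSubgroup.inclusion_injective hle)

theorem subsingleton_of_span_singleton {S : ArithmeticalStructure G} {x : S.Cokernel}
    (h : Submodule.span ℤ {x} = ⊤) : Subsingleton S.CriticalGroup := by
  obtain ⟨c, hc⟩ := S.exists_rank_eq_one
  obtain ⟨a, rfl⟩ := Submodule.mem_span_singleton.mp (h ▸ Submodule.mem_top : c ∈ _)
  refine subsingleton_of_forall_eq 0 fun t => Subtype.ext ?_
  obtain ⟨t, ht⟩ := t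
  have ht0 := rank_eq_zero_of_mem_torsion ht
  obtain ⟨i, rfl⟩ := Submodule.mem_span_singleton.mp (h ▸ Submodule.mem_top : t ∈ _)
  simp only [map_smul, smul_eq_mul] at hc ht0
  have : i = 0 := by linear_combination a * ht0 - i * hc
  simp [this]

end Generators

end ArithmeticalStructure

namespace SimpleGraph

variable {V : Type*} [Fintype V] [DecidableEq V] {G : SimpleGraph V} [DecidableRel G.Adj]

theorem eq_or_eq_of_degree_le_two {x y z u : V} (hx : G.degree x ≤ 2) (hy : G.Adj x y)
    (hz : G.Adj x z) (hyz : y ≠ z) (hu : G.Adj x u) : u = y ∨ u = z := by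
  by_contra! h
  have hs : ({u, y, z} : Finset V) ⊆ G.neighborFinset x := by
    intro w hw
    simp only [Finset.mem_insert, Finset.mem_singleton] at hw
    rw [mem_neighborFinset]
    rcases hw with rfl | rfl | rfl <;> assumption
  have hc := Finset.card_le_card hs
  rw [Finset.card_eq_three.mpr ⟨u, y, z, h.1, h.2, hyz, rfl⟩, card_neighborFinset_eq_degree] at hc
  omega

theorem eq_of_degree_le_three {x y z u w : V} (hx : G.degree x ≤ 3) (hy : G.Adj x y)
    (hz : G.Adj x z) (hyz : y ≠ z) (hu : G.Adj x u) (hw : G.Adj x w) (huy : u ≠ y) (huz : u ≠ z)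
    (hwy : w ≠ y) (hwz : w ≠ z) : u = w := by
  by_contra! h
  have hs : ({u, w, y, z} : Finset V) ⊆ G.neighborFinset x := by
    intro w hw
    simp only [Finset.mem_insert, Finset.mem_singleton] at hw
    rw [mem_neighborFinset]
    rcases hw with rfl | rfl | rfl | rfl <;> assumption
  have hc := Finset.card_le_card hs
  rw [Finset.card_insert_of_notMem (by simp [*]),
    Finset.card_eq_three.mpr ⟨w, y, z, hwy, hwz, hyz, rfl⟩, card_neighborFinset_eq_degree] at hc
  omega

end SimpleGraph

/-! ### Upper bounds: forcing generators. -/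

namespace ArithmeticalStructure

section Forcing

variable {V : Type*} [Fintype V] [DecidableEq V] {G : SimpleGraph V} [DecidableRel G.Adj]

open Submodule SimpleGraph

/-- The path is prolonged beyond `x` until it stops at a leaf `l`; forcing then runs back from `l`
to `y`, since every vertex on the way has degree at most 2. -/
theorem exists_gen_mem_span_of_isPath (S : ArithmeticalStructure G) (hG : G.IsAcyclic) {x y c : V}
    (h : G.Adj x y) (p : G.Walk y c) (hp : (Walk.cons h p).IsPath)
    (hdeg : ∀ w, w ∉ p.support → G.degree w ≤ 2) :
    ∃ l, S.gen x ∈ span ℤ {S.gen l} ∧ S.gen y ∈ span ℤ {S.gen l} := by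
  have hlt := hp.length_lt
  by_cases hz : ∃ z, G.Adj x z ∧ z ≠ y
  · obtain ⟨z, hxz, hzy⟩ := hz
    have hzp : z ∉ (Walk.cons h p).support := fun hmem =>
      hzy (by simpa using hG.eq_snd_of_adj_start hp hxz hmem)
    obtain ⟨l, hlz, hlx⟩ := S.exists_gen_mem_span_of_isPath hG hxz.symm (Walk.cons h p)
      (hp.cons hzp) fun w hw => hdeg w fun hw' => hw (by simp [hw'])
    refine ⟨l, hlx, gen_mem_of_forall_ne h hlx fun u hu huy => ?_⟩
    rcases eq_or_eq_of_degree_le_two (hdeg x ((Walk.cons_isPath_iff h p).mp hp).2) h hxz hzy.symm hu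
      with rfl | rfl
    · exact absurd rfl huy
    · exact hlz
  · push Not at hz
    exact ⟨x, mem_span_singleton_self _, gen_mem_of_forall_ne h (mem_span_singleton_self _)
      fun u hu huy => absurd (hz u hu) huy⟩
termination_by Fintype.card V - p.length
decreasing_by simp at hlt ⊢; omega

theorem exists_gen_mem_span_of_adj (S : ArithmeticalStructure G) (hG : G.IsAcyclic) {v c : V}
    (h : G.Adj v c) (hv : G.degree v ≤ 3) (hdeg : ∀ w, w ≠ v → w ≠ c → G.degree w ≤ 2) :
    ∃ l, S.gen v ∈ span ℤ {S.gen l} ∧ ∃ a, S.gen a ∈ span ℤ {S.gen l} ∧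
      ∀ u w, G.Adj v u → G.Adj v w → u ≠ c → w ≠ c → u ≠ a → w ≠ a → u = w := by
  by_cases ha : ∃ a, G.Adj v a ∧ a ≠ c
  · obtain ⟨a, hva, hac⟩ := ha
    obtain ⟨l, hla, hlv⟩ := S.exists_gen_mem_span_of_isPath hG hva.symm (Walk.cons h Walk.nil)
      (by simp [hva.ne', hac, h.ne]) (by simpa using fun w hw => hdeg w hw)
    exact ⟨l, hlv, a, hla, fun u w hu hw huc hwc hua hwa =>
      eq_of_degree_le_three hv h hva hac.symm hu hw huc hua hwc hwa⟩
  -- Here `v` is itself a leaf, so it serves as `l`; the choice `a = v` is a dummy.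
  · push Not at ha
    exact ⟨v, mem_span_singleton_self _, v, mem_span_singleton_self _,
      fun u w hu hw huc => absurd (ha u hu) huc⟩

/-- Along a walk from `v` the invariant is that the current vertex and all its neighbours are in
`N`. -/
theorem forall_gen_mem {S : ArithmeticalStructure G} {N : Submodule ℤ S.Cokernel}
    (hG : G.Connected) {v : V} (hv : S.gen v ∈ N) (hv' : ∀ u, G.Adj v u → S.gen u ∈ N)
    (hstep : ∀ w, (∀ u, G.Adj w u → S.gen u ∈ N) ∨ G.degree w ≤ 2) (w : V) : S.gen w ∈ N := by
  obtain ⟨p⟩ := hG.preconnected v w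
  induction p with
  | nil => exact hv
  | @cons v x w h p ih =>
    refine ih (hv' x h) fun u hu => ?_
    rcases hstep x with hx | hx
    · exact hx u hu
    · rcases eq_or_ne u v with rfl | huv
      · exact hv
      · refine gen_mem_of_forall_ne hu (hv' x h) fun y hy hyu => ?_
        rcases eq_or_eq_of_degree_le_two hx hu h.symm huv hy with rfl | rfl
        · exact absurd rfl hyu
        · exact hv

/-- One generator is taken at the end of a branch behind `v`, one behind `c`. Together they force
`v`, `c` and all but at most one neighbour of each, hence everything. -/
theorem isAddCyclic_of_adj (S : ArithmeticalStructure G) (hG : G.IsTree) {v c : V}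
    (h : G.Adj v c) (hv : G.degree v ≤ 3) (hc : G.degree c ≤ 3)
    (hdeg : ∀ w, w ≠ v → w ≠ c → G.degree w ≤ 2) : IsAddCyclic S.CriticalGroup := by
  obtain ⟨l, hlv, a, hla, ha⟩ := S.exists_gen_mem_span_of_adj hG.isAcyclic h hv hdeg
  obtain ⟨m, hmc, b, hmb, hb⟩ := S.exists_gen_mem_span_of_adj hG.isAcyclic h.symm hc
    fun w hw hw' => hdeg w hw' hw
  have hl : span ℤ {S.gen l} ≤ span ℤ {S.gen l, S.gen m} := span_mono (by simp)
  have hm : span ℤ {S.gen m} ≤ span ℤ {S.gen l, S.gen m} := span_mono (by simp)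
  have hnv : ∀ u, G.Adj v u → S.gen u ∈ span ℤ {S.gen l, S.gen m} := fun u hu => by
    by_cases huc : u = c
    · exact huc ▸ hm hmc
    by_cases hua : u = a
    · exact hua ▸ hl hla
    refine gen_mem_of_forall_ne hu (hl hlv) fun w hw hwu => ?_
    by_cases hwc : w = c
    · exact hwc ▸ hm hmc
    by_cases hwa : w = a
    · exact hwa ▸ hl hla
    exact absurd (ha w u hw hu hwc huc hwa hua) hwu
  have hnc : ∀ u, G.Adj c u → S.gen u ∈ span ℤ {S.gen l, S.gen m} := fun u hu => by
    by_cases huv : u = v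
    · exact huv ▸ hl hlv
    by_cases hub : u = b
    · exact hub ▸ hm hmb
    refine gen_mem_of_forall_ne hu (hm hmc) fun w hw hwu => ?_
    by_cases hwv : w = v
    · exact hwv ▸ hl hlv
    by_cases hwb : w = b
    · exact hwb ▸ hm hmb
    exact absurd (hb w u hw hu hwv huv hwb hub) hwu
  refine isAddCyclic_of_span_pair (x := S.gen l) (y := S.gen m) (eq_top_of_forall_gen_mem
    (forall_gen_mem hG.connected (hl hlv) hnv fun w => ?_))
  by_cases hwv : w = v
  · exact Or.inl (hwv ▸ hnv)
  by_cases hwc : w = c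
  · exact Or.inl (hwc ▸ hnc)
  exact Or.inr (hdeg w hwv hwc)

theorem isAddCyclic_of_forall_degree (S : ArithmeticalStructure G) (hG : G.IsTree)
    (h3 : ∀ u v, 3 ≤ G.degree u → 3 ≤ G.degree v → u ≠ v → G.Adj u v)
    (h4 : ∀ v, G.degree v ≤ 3) : IsAddCyclic S.CriticalGroup := by
  obtain ⟨v, hv⟩ : ∃ v, ∀ u, 3 ≤ G.degree u → u = v ∨ (3 ≤ G.degree v ∧ G.Adj v u) := by
    by_cases h : ∃ v, 3 ≤ G.degree v
    · obtain ⟨v, hv⟩ := h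
      exact ⟨v, fun u hu => or_iff_not_imp_left.mpr fun hne => ⟨hv, h3 v u hv hu (Ne.symm hne)⟩⟩
    · push Not at h
      exact ⟨hG.connected.nonempty.some, fun u hu => absurd (h u) (by omega)⟩
  by_cases hc : ∃ c, G.Adj v c ∧ 3 ≤ G.degree c
  · obtain ⟨c, hvc, hc⟩ := hc
    refine S.isAddCyclic_of_adj hG hvc (h4 v) (h4 c) fun w hwv hwc => ?_
    by_contra! hw
    have hvw := ((hv w hw).resolve_left hwv).2
    -- Three vertices of degree at least 3 would form a triangle.
    exact hG.isAcyclic.cliqueFree le_rfl {v, c, w}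
      (is3Clique_iff.mpr ⟨v, c, w, hvc, hvw, h3 c w hc hw (Ne.symm hwc), rfl⟩)
  · push Not at hc
    have hdeg : ∀ w, w ≠ v → G.degree w ≤ 2 := fun w hwv => by
      by_contra! hw
      have hvw := ((hv w hw).resolve_left hwv).2
      exact absurd (hc w hvw) (by omega)
    by_cases hn : ∃ c, G.Adj v c
    · obtain ⟨c, hvc⟩ := hn
      exact S.isAddCyclic_of_adj hG hvc (h4 v) (h4 c) fun w hwv _ => hdeg w hwv
    · push Not at hn
      refine isAddCyclic_of_span_pair (x := S.gen v) (y := S.gen v) (eq_top_of_forall_gen_mem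
        (forall_gen_mem hG.connected (v := v) (subset_span (by simp))
          (fun u hu => absurd hu (hn u)) fun w => ?_))
      by_cases hwv : w = v
      · exact Or.inl fun u hu => absurd (hwv ▸ hu) (hn u)
      · exact Or.inr (hdeg w hwv)

theorem subsingleton_of_iso_pathGraph (S : ArithmeticalStructure G) {n : ℕ}
    (e : G ≃g pathGraph n) : Subsingleton S.CriticalGroup := by
  rcases isEmpty_or_nonempty V with hV | ⟨⟨v₀⟩⟩
  -- The gcd of an empty family is 0.
  · exact absurd S.gcd_r (by simp)
  have hn : 0 < n := (Nat.zero_le _).trans_lt (e v₀).isLt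
  refine subsingleton_of_span_singleton (x := S.gen (e.symm ⟨0, hn⟩))
    (eq_top_of_forall_gen_mem fun v => ?_)
  have key : ∀ i (hi : i < n),
      S.gen (e.symm ⟨i, hi⟩) ∈ span ℤ {S.gen (e.symm ⟨0, hn⟩)} := by
    intro i
    induction i using Nat.strong_induction_on with
    | _ i ih =>
      intro hi
      rcases i with _ | i
      · exact mem_span_singleton_self _
      · refine gen_mem_of_forall_ne (v := e.symm ⟨i, by omega⟩)
          (by rw [e.symm.map_adj_iff, pathGraph_adj]; simp) (ih i (by omega) _) fun u hu hne => ?_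
        obtain ⟨⟨j, hj⟩, rfl⟩ := e.symm.surjective u
        rw [e.symm.map_adj_iff, pathGraph_adj] at hu
        simp only at hu
        rcases hu with rfl | hu
        · exact absurd rfl hne
        · exact ih j (by omega) hj
  simpa using key _ (e v).isLt

end Forcing

end ArithmeticalStructure

/-! ### Trees of maximum degree at most 2 are paths. -/

namespace SimpleGraph

/-- No edge leaves a longest path: interior vertices have used up their degree, and at the ends
maximality and acyclicity forbid it. Connectedness does the rest. -/
theorem IsTree.exists_iso_pathGraph {V : Type*} [Fintype V] [DecidableEq V] {G : SimpleGraph V}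
    [DecidableRel G.Adj] (hG : G.IsTree) (hdeg : ∀ v, G.degree v ≤ 2) :
    ∃ n : ℕ, Nonempty (G ≃g pathGraph n) := by
  have := hG.connected.nonempty
  obtain ⟨u, v, p, hp, hmax⟩ := Walk.exists_isPath_forall_isPath_length_le_length G
  have start : ∀ {a b : V} (q : G.Walk a b), q.IsPath → q.length = p.length →
      ∀ w, G.Adj a w → q.toSubgraph.Adj a w := by
    intro a b q hq hlen w hw
    by_cases hwq : w ∈ q.support
    · have hnil : ¬ q.Nil := fun hnil => by
        cases hnil
        simp only [Walk.support_nil, List.mem_singleton] at hwq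
        exact hw.ne hwq.symm
      rw [hG.isAcyclic.eq_snd_of_adj_start hq hw hwq]
      exact q.toSubgraph_adj_snd hnil
    · have := hmax _ _ (Walk.cons hw.symm q) (hq.cons hwq)
      rw [Walk.length_cons] at this
      omega
  have hadj : ∀ x ∈ p.support, ∀ w, G.Adj x w → p.toSubgraph.Adj x w := by
    intro x hx w hw
    obtain ⟨i, rfl, hi⟩ := Walk.mem_support_iff_exists_getVert.mp hx
    rcases Nat.eq_zero_or_pos i with rfl | hi0
    · rw [Walk.getVert_zero] at hw ⊢
      exact start p hp rfl w hw
    rcases hi.eq_or_lt with rfl | hlt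
    · rw [Walk.getVert_length] at hw ⊢
      simpa using start p.reverse hp.reverse (by simp) w hw
    have hs : p.toSubgraph.neighborSet (p.getVert i) ⊆ G.neighborSet (p.getVert i) :=
      p.toSubgraph.neighborSet_subset _
    have heq := Set.eq_of_subset_of_ncard_le hs (by
      rw [hp.ncard_neighborSet_toSubgraph_internal_eq_two hi0.ne' hlt, ← Nat.card_coe_set_eq,
        Nat.card_eq_fintype_card, card_neighborSet_eq_degree]
      exact hdeg _)
    exact (Set.ext_iff.mp heq w).mpr hw
  have hverts : ∀ x, x ∈ p.support := by
    intro x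
    obtain ⟨q⟩ := hG.connected.preconnected u x
    have : ∀ {a b : V}, G.Walk a b → a ∈ p.support → b ∈ p.support := by
      intro a b q ha
      induction q with
      | nil => exact ha
      | cons h q ih => exact ih ((p.mem_verts_toSubgraph).mp (hadj _ ha _ h).snd_mem)
    exact this q p.start_mem_support
  have htop : p.toSubgraph = ⊤ := by
    refine Subgraph.ext (Set.eq_univ_of_forall fun x => p.mem_verts_toSubgraph.mpr (hverts x)) ?_
    ext x y
    exact ⟨fun h => h.adj_sub, fun h => hadj x (hverts x) y h⟩
  have e := hp.pathGraphIsoToSubgraph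
  rw [htop] at e
  exact ⟨_, ⟨(e.trans Subgraph.topIso).symm⟩⟩

end SimpleGraph

/-! ### Branches of a tree at a vertex. -/

namespace SimpleGraph

variable {V : Type*} {G : SimpleGraph V}

/-- The vertices of the component of `a` after deletion of the edge between `v` and `a`. -/
def branch (G : SimpleGraph V) (v a : V) : Set V :=
  {w | (G.deleteEdges {s(v, a)}).Reachable a w}

theorem mem_branch_self (v a : V) : a ∈ G.branch v a :=
  Reachable.refl a

theorem IsAcyclic.notMem_branch (hG : G.IsAcyclic) {v a : V} (h : G.Adj v a) :
    v ∉ G.branch v a := fun hv =>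
  isBridge_iff.mp (isAcyclic_iff_forall_adj_isBridge.mp hG h) (Reachable.symm hv)

theorem mem_branch_of_adj {v a x y : V} (hx : x ∈ G.branch v a) (h : G.Adj x y)
    (hne : s(x, y) ≠ s(v, a)) : y ∈ G.branch v a :=
  Reachable.trans (v := x) hx
    (Adj.reachable (by simpa [deleteEdges_adj] using ⟨h, by simpa using hne⟩))

theorem notMem_branch_of_adj {v a x y : V} (hx : x ∉ G.branch v a) (h : G.Adj x y)
    (hxv : x ≠ v) : y ∉ G.branch v a := fun hy => hx <| mem_branch_of_adj hy h.symm fun he => by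
  rcases Sym2.eq_iff.mp he with ⟨-, rfl⟩ | ⟨-, h2⟩
  · exact hx (mem_branch_self v x)
  · exact hxv h2

theorem IsAcyclic.notMem_branch_of_adj (hG : G.IsAcyclic) {v a b : V} (ha : G.Adj v a)
    (hb : G.Adj v b) (hab : b ≠ a) : b ∉ G.branch v a := fun hy =>
  hG.notMem_branch ha <| mem_branch_of_adj hy hb.symm fun he => by
    rcases Sym2.eq_iff.mp he with ⟨h1, -⟩ | ⟨h1, -⟩
    · exact hb.ne h1.symm
    · exact hab h1

/-- The intersection of two distinct branches is closed under adjacency, so if nonempty it would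
contain `v`. -/
theorem IsTree.branch_eq_of_mem (hG : G.IsTree) {v a b w : V} (ha : G.Adj v a) (hb : G.Adj v b)
    (hwa : w ∈ G.branch v a) (hwb : w ∈ G.branch v b) : a = b := by
  by_contra hab
  have hclosed : ∀ {x y : V}, G.Adj x y → x ∈ G.branch v a → x ∈ G.branch v b →
      y ∈ G.branch v a ∧ y ∈ G.branch v b := by
    intro x y h hxa hxb
    have hxv : x ≠ v := fun h => hG.isAcyclic.notMem_branch ha (h ▸ hxa)
    refine ⟨mem_branch_of_adj hxa h fun he => ?_, mem_branch_of_adj hxb h fun he => ?_⟩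
    · rcases Sym2.eq_iff.mp he with ⟨h1, -⟩ | ⟨h1, -⟩
      · exact hxv h1
      · exact hG.isAcyclic.notMem_branch_of_adj hb ha hab (h1 ▸ hxb)
    · rcases Sym2.eq_iff.mp he with ⟨h1, -⟩ | ⟨h1, -⟩
      · exact hxv h1
      · exact hG.isAcyclic.notMem_branch_of_adj ha hb (Ne.symm hab) (h1 ▸ hxa)
  have hwalk : ∀ {x y : V}, G.Walk x y → x ∈ G.branch v a → x ∈ G.branch v b →
      y ∈ G.branch v a := by
    intro x y q
    induction q with
    | nil => exact fun hx _ => hx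
    | cons h q ih => exact fun hx hx' => ih (hclosed h hx hx').1 (hclosed h hx hx').2
  obtain ⟨q⟩ := hG.connected.preconnected w v
  exact hG.isAcyclic.notMem_branch ha (hwalk q hwa hwb)

theorem IsTree.exists_adj_notMem_branch [Fintype V] [DecidableRel G.Adj] (hG : G.IsTree) {u v : V}
    (hu : 3 ≤ G.degree u) : ∃ a b, a ≠ b ∧ G.Adj u a ∧ G.Adj u b ∧
      v ∉ G.branch u a ∧ v ∉ G.branch u b := by
  rw [← card_neighborFinset_eq_degree] at hu
  obtain ⟨a, b, c, ha, hb, hc, hab, hac, hbc⟩ := Finset.two_lt_card_iff.mp hu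
  rw [mem_neighborFinset] at ha hb hc
  by_cases hva : v ∈ G.branch u a
  · exact ⟨b, c, hbc, hb, hc, fun h => hab (hG.branch_eq_of_mem ha hb hva h),
      fun h => hac (hG.branch_eq_of_mem ha hc hva h)⟩
  by_cases hvb : v ∈ G.branch u b
  · exact ⟨a, c, hac, ha, hc, hva, fun h => hbc (hG.branch_eq_of_mem hb hc hvb h)⟩
  · exact ⟨a, b, hab, ha, hb, hva, hvb⟩

end SimpleGraph

/-! ### Lower bounds: structures with large critical group. -/

namespace ArithmeticalStructure

section Construction

variable {V : Type*} [Fintype V] [DecidableEq V] {G : SimpleGraph V} [DecidableRel G.Adj]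

open SimpleGraph

/-- The arithmetical structure with `r` equal to the degree on an independent set `W` and to `1`
elsewhere. -/
def ofIndependent (G : SimpleGraph V) [DecidableRel G.Adj] (W : Finset V)
    (hW : ∀ u ∈ W, ∀ v ∈ W, ¬ G.Adj u v) (hpos : ∀ u ∈ W, 0 < G.degree u) (hne : ∃ u, u ∉ W) :
    ArithmeticalStructure G where
  r v := if v ∈ W then G.degree v else 1
  d v := if v ∈ W then 1 else ∑ u ∈ G.neighborFinset v, if u ∈ W then (G.degree u : ℤ) else 1
  d_nonneg v := by
    split_ifs
    · exact zero_le_one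
    · exact Finset.sum_nonneg fun u _ => by split_ifs <;> positivity
  r_pos v := by
    split_ifs with h
    · exact_mod_cast hpos v h
    · exact zero_lt_one
  gcd_r := by
    obtain ⟨u, hu⟩ := hne
    have h := Finset.gcd_dvd (f := fun v => if v ∈ W then (G.degree v : ℤ) else 1)
      (Finset.mem_univ u)
    rw [if_neg hu] at h
    rw [← Finset.normalize_gcd]
    exact normalize_eq_one.mpr (isUnit_of_dvd_one h)
  mulVec_eq_zero := by
    ext v
    simp only [Matrix.sub_mulVec, Matrix.mulVec_diagonal, Pi.sub_apply, Pi.zero_apply,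
      adjMatrix_mulVec_apply]
    split_ifs with hv
    · rw [Finset.sum_congr rfl fun u hu => if_neg fun hu' =>
        hW v hv u hu' ((G.mem_neighborFinset v u).mp hu)]
      simp
    · simp

open Classical in
/-- The indicator function of a branch. -/
noncomputable def branchIndicator (R : Type*) [CommRing R] (G : SimpleGraph V) (v a w : V) : R :=
  if w ∈ G.branch v a then 1 else 0

variable {W : Finset V} {hW : ∀ u ∈ W, ∀ v ∈ W, ¬ G.Adj u v} {hpos : ∀ u ∈ W, 0 < G.degree u}
  {hne : ∃ u, u ∉ W} {R : Type*} [CommRing R]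

/-- On a branch avoiding `W` the indicator agrees with `r`, which is in the kernel; the error terms
come only from the edge between `v` and `a`. The term at `v` does not depend on `a`, so it cancels
in differences. -/
theorem ofIndependent_d_mul_branchIndicator (hG : G.IsAcyclic) {v a : V} (hv : v ∈ W)
    (ha : G.Adj v a) (hB : ∀ u ∈ W, u ∉ G.branch v a) (x : V) :
    ((ofIndependent G W hW hpos hne).d x : R) * branchIndicator R G v a x =
      ∑ u ∈ G.neighborFinset x, branchIndicator R G v a u +
        ((G.degree v : R) * (if x = a then 1 else 0) - if x = v then 1 else 0) := by
  by_cases hxB : x ∈ G.branch v a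
  · have hxW : x ∉ W := fun h => hB x h hxB
    have hxv : x ≠ v := fun h => hxW (h ▸ hv)
    have hu : ∀ u ∈ G.neighborFinset x, ((if u ∈ W then (G.degree u : ℤ) else 1 : ℤ) : R) =
        branchIndicator R G v a u + if u = v then (G.degree v : R) else 0 := by
      intro u hu
      rw [mem_neighborFinset] at hu
      by_cases huv : u = v
      · subst huv
        simp [hv, branchIndicator, hB u hv]
      · have huB : u ∈ G.branch v a := mem_branch_of_adj hxB hu fun he => by
          rcases Sym2.eq_iff.mp he with ⟨h1, -⟩ | ⟨-, h1⟩
          · exact hxv h1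
          · exact huv h1
        have huW : u ∉ W := fun h => hB u h huB
        simp [huW, branchIndicator, huB, huv]
    simp only [ofIndependent, if_neg hxW, Int.cast_sum]
    rw [Finset.sum_congr rfl hu, Finset.sum_add_distrib, Finset.sum_ite_eq']
    have hiff : v ∈ G.neighborFinset x ↔ x = a := by
      rw [mem_neighborFinset]
      refine ⟨fun h => ?_, fun h => h ▸ ha.symm⟩
      by_contra hxa
      exact hG.notMem_branch_of_adj ha h.symm hxa hxB
    simp [hiff, hxv, branchIndicator, hxB]
  · have hxa : x ≠ a := fun h => hxB (by rw [h]; exact mem_branch_self v a)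
    have hx0 : branchIndicator R G v a x = 0 := if_neg hxB
    rw [hx0, if_neg hxa]
    by_cases hxv : x = v
    · subst hxv
      rw [Finset.sum_eq_single a]
      · simp [branchIndicator, mem_branch_self]
      · intro b hb hba
        exact if_neg (hG.notMem_branch_of_adj ha ((G.mem_neighborFinset x b).mp hb) hba)
      · intro h
        exact absurd ((G.mem_neighborFinset x a).mpr ha) h
    · have h0 : ∀ u ∈ G.neighborFinset x, branchIndicator R G v a u = 0 := fun u hu =>
        if_neg (notMem_branch_of_adj hxB ((G.mem_neighborFinset x u).mp hu) hxv)
      rw [if_neg hxv, Finset.sum_eq_zero h0]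
      simp

theorem gen_sub_gen_mem_torsion (hG : G.IsAcyclic) {v a b : V} (hv : v ∈ W)
    (ha : G.Adj v a) (hb : G.Adj v b) (hBa : ∀ u ∈ W, u ∉ G.branch v a)
    (hBb : ∀ u ∈ W, u ∉ G.branch v b) :
    (ofIndependent G W hW hpos hne).gen a - (ofIndependent G W hW hpos hne).gen b ∈
      AddCommGroup.torsion (ofIndependent G W hW hpos hne).Cokernel := by
  set S := ofIndependent G W hW hpos hne
  refine isOfFinAddOrder_iff_nsmul_eq_zero.mpr ⟨G.degree v, hpos v hv, ?_⟩
  have h : (Submodule.Quotient.mk (S.laplacian.mulVec fun x =>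
      branchIndicator ℤ G v a x - branchIndicator ℤ G v b x) : S.Cokernel) = 0 :=
    (Submodule.Quotient.mk_eq_zero _).mpr ⟨_, rfl⟩
  have hx : S.laplacian.mulVec (fun x =>
      branchIndicator ℤ G v a x - branchIndicator ℤ G v b x) =
      (G.degree v) • (Pi.single a 1 - Pi.single b 1 : V → ℤ) := by
    ext x
    rw [laplacian_mulVec_apply, mul_sub, Finset.sum_sub_distrib]
    have h1 := ofIndependent_d_mul_branchIndicator (R := ℤ) (hW := hW) (hpos := hpos) (hne := hne)
      hG hv ha hBa x
    have h2 := ofIndependent_d_mul_branchIndicator (R := ℤ) (hW := hW) (hpos := hpos) (hne := hne)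
      hG hv hb hBb x
    simp only [Int.cast_id] at h1 h2
    simp only [Pi.smul_apply, Pi.sub_apply, Pi.single_apply, nsmul_eq_mul]
    linear_combination h1 - h2
  rw [hx] at h
  exact h

/-- The homomorphism to a ring killed by `deg v` given by the difference of two branches at `v`. -/
noncomputable def branchPairing (hG : G.IsAcyclic) {v a b : V} (hv : v ∈ W)
    (ha : G.Adj v a) (hb : G.Adj v b) (hBa : ∀ u ∈ W, u ∉ G.branch v a)
    (hBb : ∀ u ∈ W, u ∉ G.branch v b) (hR : (G.degree v : R) = 0) :
    (ofIndependent G W hW hpos hne).Cokernel →ₗ[ℤ] R :=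
  pairing _ (fun x => branchIndicator R G v a x - branchIndicator R G v b x) fun x => by
    have h1 := ofIndependent_d_mul_branchIndicator (R := R) (hW := hW) (hpos := hpos) (hne := hne)
      hG hv ha hBa x
    have h2 := ofIndependent_d_mul_branchIndicator (R := R) (hW := hW) (hpos := hpos) (hne := hne)
      hG hv hb hBb x
    rw [hR] at h1 h2
    rw [Finset.sum_sub_distrib]
    linear_combination h1 - h2

@[simp]
theorem branchPairing_gen (hG : G.IsAcyclic) {v a b : V} (hv : v ∈ W)
    (ha : G.Adj v a) (hb : G.Adj v b) (hBa : ∀ u ∈ W, u ∉ G.branch v a)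
    (hBb : ∀ u ∈ W, u ∉ G.branch v b) (hR : (G.degree v : R) = 0) (w : V) :
    branchPairing (hW := hW) (hpos := hpos) (hne := hne) hG hv ha hb hBa hBb hR
      ((ofIndependent G W hW hpos hne).gen w) =
      branchIndicator R G v a w - branchIndicator R G v b w :=
  pairing_gen _ _ _ _

/-- If `s` and `t` are multiples of one element, the 2×2 determinant of values vanishes. -/
theorem not_isAddCyclic_of_mul_ne {S : ArithmeticalStructure G} {s t : S.Cokernel}
    (hs : s ∈ AddCommGroup.torsion S.Cokernel) (ht : t ∈ AddCommGroup.torsion S.Cokernel)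
    (f g : S.Cokernel →ₗ[ℤ] R) (h : f s * g t ≠ f t * g s) : ¬ IsAddCyclic S.CriticalGroup := by
  rintro ⟨γ, hγ⟩
  obtain ⟨m, hm⟩ := AddSubgroup.mem_zmultiples_iff.mp (hγ ⟨s, hs⟩)
  obtain ⟨n, hn⟩ := AddSubgroup.mem_zmultiples_iff.mp (hγ ⟨t, ht⟩)
  have hm' : m • (γ : S.Cokernel) = s := congrArg Subtype.val hm
  have hn' : n • (γ : S.Cokernel) = t := congrArg Subtype.val hn
  apply h
  simp only [← hm', ← hn', map_zsmul, zsmul_eq_mul]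
  ring

theorem exists_not_subsingleton (hG : G.IsTree) {v : V} (hv : 3 ≤ G.degree v) :
    ∃ S : ArithmeticalStructure G, ¬ Subsingleton S.CriticalGroup := by
  have hcard := hv
  rw [← card_neighborFinset_eq_degree] at hcard
  obtain ⟨a, b, c, ha, hb, hc, hab, hac, hbc⟩ := Finset.two_lt_card_iff.mp hcard
  rw [mem_neighborFinset] at ha hb hc
  have hA := hG.isAcyclic
  have hB : ∀ {x}, G.Adj v x → ∀ u ∈ ({v} : Finset V), u ∉ G.branch v x := fun hx u hu => by
    rw [Finset.mem_singleton.mp hu]; exact hA.notMem_branch hx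
  have hvW : v ∈ ({v} : Finset V) := Finset.mem_singleton_self v
  have : Fact (1 < G.degree v) := ⟨by omega⟩
  have hR : (G.degree v : ZMod (G.degree v)) = 0 := ZMod.natCast_self _
  refine ⟨ofIndependent G {v} (by simp) (by simp; omega) ⟨a, by simpa using ha.ne'⟩, fun hS => ?_⟩
  have h0 := hS.elim ⟨_, gen_sub_gen_mem_torsion hA hvW ha hb (hB ha) (hB hb)⟩ 0
  have h1 := congrArg (branchPairing hA hvW ha hc (hB ha) (hB hc) hR) (congrArg Subtype.val h0)
  simp [branchIndicator, mem_branch_self, hA.notMem_branch_of_adj ha hb hab.symm,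
    hA.notMem_branch_of_adj hc ha hac, hA.notMem_branch_of_adj hc hb hbc] at h1

theorem exists_not_isAddCyclic_of_four_le_degree (hG : G.IsTree) {v : V} (hv : 4 ≤ G.degree v) :
    ∃ S : ArithmeticalStructure G, ¬ IsAddCyclic S.CriticalGroup := by
  have hcard := hv
  rw [← card_neighborFinset_eq_degree] at hcard
  obtain ⟨a, b, c, e, ha, hb, hc, he, hab, hac, hae, hbc, hbe, hce⟩ :=
    Finset.three_lt_card_iff.mp hcard
  rw [mem_neighborFinset] at ha hb hc he
  have hA := hG.isAcyclic
  have hB : ∀ {x}, G.Adj v x → ∀ u ∈ ({v} : Finset V), u ∉ G.branch v x := fun hx u hu => by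
    rw [Finset.mem_singleton.mp hu]; exact hA.notMem_branch hx
  have hvW : v ∈ ({v} : Finset V) := Finset.mem_singleton_self v
  have : Fact (1 < G.degree v) := ⟨by omega⟩
  have hR : (G.degree v : ZMod (G.degree v)) = 0 := ZMod.natCast_self _
  refine ⟨ofIndependent G {v} (by simp) (by simp; omega) ⟨a, by simpa using ha.ne'⟩,
    not_isAddCyclic_of_mul_ne (gen_sub_gen_mem_torsion hA hvW ha hb (hB ha) (hB hb))
      (gen_sub_gen_mem_torsion hA hvW ha hc (hB ha) (hB hc))
      (branchPairing hA hvW he hb (hB he) (hB hb) hR)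
      (branchPairing hA hvW he hc (hB he) (hB hc) hR) ?_⟩
  -- The fourth branch `e` makes the matrix of values the identity.
  simp [branchIndicator, mem_branch_self, hA.notMem_branch_of_adj he ha hae,
    hA.notMem_branch_of_adj he hb hbe, hA.notMem_branch_of_adj he hc hce,
    hA.notMem_branch_of_adj hb ha hab, hA.notMem_branch_of_adj hc ha hac,
    hA.notMem_branch_of_adj hb hc hbc.symm, hA.notMem_branch_of_adj hc hb hbc]

theorem exists_not_isAddCyclic_of_not_adj (hG : G.IsTree) {u v : V} (huv : u ≠ v)
    (hadj : ¬ G.Adj u v) (hu : G.degree u = 3) (hv : G.degree v = 3) :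
    ∃ S : ArithmeticalStructure G, ¬ IsAddCyclic S.CriticalGroup := by
  have hA := hG.isAcyclic
  obtain ⟨a, a', haa, ha, ha', hva, hva'⟩ := hG.exists_adj_notMem_branch (v := v) hu.ge
  obtain ⟨b, b', hbb, hb, hb', hub, hub'⟩ := hG.exists_adj_notMem_branch (v := u) hv.ge
  have hBu : ∀ {x}, G.Adj u x → v ∉ G.branch u x →
      ∀ w ∈ ({u, v} : Finset V), w ∉ G.branch u x := fun hx hvx w hw => by
    rcases Finset.mem_insert.mp hw with rfl | hw
    · exact hA.notMem_branch hx
    · exact Finset.mem_singleton.mp hw ▸ hvx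
  have hBv : ∀ {x}, G.Adj v x → u ∉ G.branch v x →
      ∀ w ∈ ({u, v} : Finset V), w ∉ G.branch v x := fun hx hux w hw => by
    rcases Finset.mem_insert.mp hw with rfl | hw
    · exact hux
    · rw [Finset.mem_singleton.mp hw]; exact hA.notMem_branch hx
  have huW : u ∈ ({u, v} : Finset V) := by simp
  have hvW : v ∈ ({u, v} : Finset V) := by simp
  have hRu : (G.degree u : ZMod 3) = 0 := by rw [hu]; rfl
  have hRv : (G.degree v : ZMod 3) = 0 := by rw [hv]; rfl
  have hau : a ∉ ({u, v} : Finset V) := by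
    simp only [Finset.mem_insert, Finset.mem_singleton, not_or]
    exact ⟨ha.ne', fun h => hadj (h ▸ ha)⟩
  refine ⟨ofIndependent G {u, v} (by simp [hadj, G.adj_comm v u]) (by simp [hu, hv]) ⟨a, hau⟩,
    not_isAddCyclic_of_mul_ne
      (gen_sub_gen_mem_torsion hA huW ha ha' (hBu ha hva) (hBu ha' hva'))
      (gen_sub_gen_mem_torsion hA hvW hb hb' (hBv hb hub) (hBv hb' hub'))
      (branchPairing hA huW ha ha' (hBu ha hva) (hBu ha' hva') hRu)
      (branchPairing hA hvW hb hb' (hBv hb hub) (hBv hb' hub') hRv) ?_⟩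
  -- The diagonal values are 2, and the functional at `u` vanishes on `b` and `b'`; the determinant
  -- is 4, nonzero in `ZMod 3`.
  simp [branchIndicator, mem_branch_self, hA.notMem_branch_of_adj ha ha' haa.symm,
    hA.notMem_branch_of_adj ha' ha haa, hA.notMem_branch_of_adj hb hb' hbb.symm,
    hA.notMem_branch_of_adj hb' hb hbb, notMem_branch_of_adj hva hb huv.symm,
    notMem_branch_of_adj hva' hb huv.symm, notMem_branch_of_adj hva hb' huv.symm,
    notMem_branch_of_adj hva' hb' huv.symm]
  decide

end Construction

end ArithmeticalStructure

theorem corollary4p4 {V : Type*} [Fintype V] [DecidableEq V]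
    (T : SimpleGraph V) [DecidableRel T.Adj] (hT : T.IsTree) :
    ((∀ S : ArithmeticalStructure T, IsAddCyclic S.CriticalGroup) ↔
      ((¬ ∃ u v : V, u ≠ v ∧ ¬ T.Adj u v ∧ 3 ≤ T.degree u ∧ 3 ≤ T.degree v) ∧
        ¬ ∃ v : V, 4 ≤ T.degree v)) ∧
    ((∀ S : ArithmeticalStructure T, Subsingleton S.CriticalGroup) ↔
      ∃ n : ℕ, Nonempty (T ≃g SimpleGraph.pathGraph n)) := by
  refine ⟨⟨fun h => ?_, fun ⟨h3, h4⟩ S => ?_⟩, fun h => ?_, fun ⟨n, ⟨e⟩⟩ S =>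
    S.subsingleton_of_iso_pathGraph e⟩
  · have h4 : ¬ ∃ v : V, 4 ≤ T.degree v := fun ⟨v, hv⟩ => by
      obtain ⟨S, hS⟩ := ArithmeticalStructure.exists_not_isAddCyclic_of_four_le_degree hT hv
      exact hS (h S)
    -- With (b) known, both degrees equal 3, so both functionals take values in `ZMod 3`.
    refine ⟨fun ⟨u, v, huv, hadj, hu, hv⟩ => ?_, h4⟩
    push Not at h4
    obtain ⟨S, hS⟩ := ArithmeticalStructure.exists_not_isAddCyclic_of_not_adj hT huv hadj
      (by have := h4 u; omega) (by have := h4 v; omega)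
    exact hS (h S)
  · push Not at h3 h4
    refine S.isAddCyclic_of_forall_degree hT (fun u v hu hv huv => ?_) fun v => by
      have := h4 v
      omega
    by_contra hadj
    exact absurd (h3 u v huv hadj hu) (by omega)
  · refine hT.exists_iso_pathGraph fun v => ?_
    by_contra! hv
    obtain ⟨S, hS⟩ := ArithmeticalStructure.exists_not_subsingleton hT hv
    exact hS (h S)
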